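/- Let $n\ge 0$ and let $w\in S_n$ be a permutation of $\{1,\dots,n\}$, with one-line notation $w_1w_2\cdots w_n$. Let $\operatorname{Dsl}(w)=\{1\le i\le n-1 : w_{i+1}<w_i\}$ be its set of descending locations. Let $Q(w)$ be the recording tableau that the Robinson--Schensted(--Knuth) algorithm (row insertion of $w_1,\dots,w_n$) attaches to $w$, and let $\tilde Q(w)=\operatorname{ev}Q(w)$ be its Schützenberger evacuation: for a standard Young tableau $S$ with $n$ boxes, $\Delta S$ is obtained by removing the minimal entry from the upper left box, performing the jeu de taquin slide into this box, and deleting the box vacated at the end; $\operatorname{ev}S$ has the shape of $S$ and contains $n-i$ in the box vacated in passing from $\Delta^iS$ to $\Delta^{i+1}S$, for $0\le i<n$. For a standard Young tableau $S$ with $n$ boxes (English notation), let $\operatorname{Dsi}(S)$ be the set of those $1\le i\le n-1$ such that $i+1$ lies in $S$ in a strictly lower row than $i$, and in a column weakly to the left of that of $i$. The cocharge tableau $\operatorname{ct}(S)$ is obtained from $S$ by replacing every entry $p$ by the number of elements $j\in\operatorname{Dsi}(S)$ with $j<p$, and the cocharge $\operatorname{cc}(S)$ is the sum of the entries of $\operatorname{ct}(S)$.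 Then $$\operatorname{cc}\big(\tilde Q(w)\big)=\sum_{i\in\operatorname{Dsl}(w)}i,$$ the major index of $w$. Moreover, this parameter does not change when $w$ is considered as an element of $S_{n+1}$: if $w_+\in S_{n+1}$ acts on $\{1,\dots,n\}$ like $w$ and fixes $n+1$, then $\operatorname{cc}\big(\tilde Q(w_+)\big)=\operatorname{cc}\big(\tilde Q(w)\big)$. -/

import Mathlib

namespace CochargeRSK

/-- A tableau: a finite set of boxes, together with a natural number in every box.
Boxes are written as `(row, column)` in the English notation, both counted from `0`.
The values of `entry` outside `cells` are irrelevant. -/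
structure Tableau where
  cells : Finset (ℕ × ℕ)
  entry : ℕ × ℕ → ℕ

/-! ### Permutations in one-line notation -/

/-- The `i`-th entry `w_i ∈ {1, …, n}`, for `1 ≤ i ≤ n`, of the one-line notation of `w ∈ S_n`
(`Fin n` is identified with `{1, …, n}` by adding `1`; the value is `0` for other `i`). -/
def oneLine {n : ℕ} (w : Equiv.Perm (Fin n)) (i : ℕ) : ℕ :=
  if h : 1 ≤ i ∧ i ≤ n then (w ⟨i - 1, by omega⟩ : ℕ) + 1 else 0

/-- The descending locations of `w`: those `1 ≤ i ≤ n - 1` with `w_{i+1} < w_i`. -/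
def Dsl {n : ℕ} (w : Equiv.Perm (Fin n)) : Finset ℕ :=
  (Finset.Icc 1 (n - 1)).filter fun i => oneLine w (i + 1) < oneLine w i

/-- The image `w₊` of `w ∈ S_n` in `S_{n+1}`: it acts on `{1, …, n}` like `w` and fixes `n + 1`. -/
def plus {n : ℕ} (w : Equiv.Perm (Fin n)) : Equiv.Perm (Fin (n + 1)) :=
  w.viaFintypeEmbedding Fin.castSuccEmb

/-! ### The Robinson--Schensted correspondence by row insertion -/

/-- Inserting `x` into a row: `x` replaces the first entry that is larger than `x`, and this
entry is bumped out (`some y`); if there is none, `x` is put at the end of the row (`none`). -/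
def rowInsert (x : ℕ) : List ℕ → List ℕ × Option ℕ
  | [] => ([x], none)
  | y :: ys =>
    if x < y then (x :: ys, some y)
    else (y :: (rowInsert x ys).1, (rowInsert x ys).2)

/-- Row insertion of `x` into a tableau given by the list of its rows: `x` is inserted into the
first row, the entry bumped out of a row is inserted into the next one. The result is the new
tableau, with the box in which the insertion terminates, i.e., the box that was added. -/
def rowInsertion (x : ℕ) : List (List ℕ) → List (List ℕ) × (ℕ × ℕ)
  | [] => ([[x]], (0, 0))
  | r :: rs =>
    match rowInsert x r with
    | (r', none) => (r' :: rs, (0, r.length))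
    | (r', some y) =>
      (r' :: (rowInsertion y rs).1, ((rowInsertion y rs).2.1 + 1, (rowInsertion y rs).2.2))

/-- The insertion tableau `P_k` (by rows) after inserting `u 1, …, u k` successively. -/
def insertionTableau (u : ℕ → ℕ) : ℕ → List (List ℕ)
  | 0 => []
  | k + 1 => (rowInsertion (u (k + 1)) (insertionTableau u k)).1

/-- The recording tableau `Q_k`: at the `k`-th step, `k` is placed into the box that the
insertion of `u k` adds. -/
def recordingTableau (u : ℕ → ℕ) : ℕ → Tableau
  | 0 => ⟨∅, fun _ => 0⟩
  | k + 1 =>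
    let box := (rowInsertion (u (k + 1)) (insertionTableau u k)).2
    ⟨insert box (recordingTableau u k).cells,
      Function.update (recordingTableau u k).entry box (k + 1)⟩

/-- The tableau `Q(w)` that the RSK algorithm attaches to `w ∈ S_n`. -/
def Q {n : ℕ} (w : Equiv.Perm (Fin n)) : Tableau :=
  recordingTableau (oneLine w) n

/-! ### Schützenberger evacuation -/

/-- One step of a jeu de taquin slide of `T` with the empty box `c`: the smaller one among the
entries to the right of `c` and below `c` (the existing one, if there is only one) moves into `c`,
and its box becomes the empty one. Nothing changes if there is no box to the right or below. -/
def slideStep : Tableau × (ℕ × ℕ) → Tableau × (ℕ × ℕ)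
  | (T, c) =>
    let right : ℕ × ℕ := (c.1, c.2 + 1)
    let below : ℕ × ℕ := (c.1 + 1, c.2)
    if right ∈ T.cells ∧ (below ∈ T.cells → T.entry right < T.entry below) then
      (⟨T.cells, Function.update T.entry c (T.entry right)⟩, right)
    else if below ∈ T.cells then
      (⟨T.cells, Function.update T.entry c (T.entry below)⟩, below)
    else (T, c)

/-- The full slide of `T` after emptying the upper left box: the resulting filling, and the box
that is empty at the end. (As every step which is not the last one reaches another box of `T`,
the slide is over after `T.cells.card` steps.) -/
def slide (T : Tableau) : Tableau × (ℕ × ℕ) :=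
  slideStep^[T.cells.card] (T, (0, 0))

/-- The box that is vacated when passing from `T` to `Δ T`. -/
def vacated (T : Tableau) : ℕ × ℕ := (slide T).2

/-- The operator `Δ`: the minimal entry, which is in the upper left box, is removed, a jeu de
taquin slide into this box is performed, and the vacated box is deleted. -/
def Δ (T : Tableau) : Tableau :=
  ⟨T.cells.erase (vacated T), (slide T).1.entry⟩

/-- The entries of the evacuation of a tableau `T` with `m` boxes: `m` is placed into the box that
is vacated when passing from `T` to `Δ T`, and the other boxes are filled using `Δ T`.
Hence for `T` with `n` boxes, the box vacated when passing from `Δ^i T` to `Δ^(i+1) T`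
contains `n - i`. -/
def evEntry : ℕ → Tableau → ℕ × ℕ → ℕ
  | 0, _ => fun _ => 0
  | m + 1, T => Function.update (evEntry m (Δ T)) (vacated T) (m + 1)

/-- The evacuation `ev T` of a standard Young tableau `T`; it has the same shape as `T`. -/
def ev (T : Tableau) : Tableau :=
  ⟨T.cells, evEntry T.cells.card T⟩

/-- The tableau `Q̃(w) = ev Q(w)`. -/
def Qtilde {n : ℕ} (w : Equiv.Perm (Fin n)) : Tableau := ev (Q w)

/-! ### Descending indices and cocharge -/

/-- The descending indices of a standard Young tableau `S` with `n` boxes: those `1 ≤ i ≤ n - 1`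
for which the box `b` of `i + 1` satisfies `R(b) > R(a)` and `C(b) ≤ C(a)`, for `a` the box
of `i`. -/
def Dsi (S : Tableau) : Finset ℕ :=
  (Finset.Icc 1 (S.cells.card - 1)).filter fun i =>
    ∃ a ∈ S.cells, ∃ b ∈ S.cells,
      S.entry a = i ∧ S.entry b = i + 1 ∧ a.1 < b.1 ∧ b.2 ≤ a.2

/-- The destandardization `ct_J(S)`: every entry `p` of `S` is replaced by the number of elements
of `J` that are smaller than `p`. -/
def ctOn (J : Finset ℕ) (S : Tableau) : Tableau :=
  ⟨S.cells, fun c => (J.filter fun j => j < S.entry c).card⟩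

/-- The cocharge tableau `ct(S)`. -/
def ct (S : Tableau) : Tableau := ctOn (Dsi S) S

/-- The cocharge of `S`: the sum of the entries of the cocharge tableau `ct(S)`. -/
def cc (S : Tableau) : ℕ := ∑ c ∈ (ct S).cells, (ct S).entry c

end CochargeRSK

namespace CochargeRSK

/-! ### Row insertion into a single row -/

/-! Call `i` a descent of a standard tableau when `i + 1` lies in a strictly lower row. The theorem
combines three facts. (1) The descents of `Q(w)` are the descending locations of `w`. For two
successive row insertions, the second new box is strictly lower exactly when the second letter is
smaller (`rowInsertion_row_lt_iff`). (2) Evacuation reverses descents: `i` is in `Dsi (ev T)` iff `n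
- i` is a descent of `T` (`evEntry_descent`). A jeu de taquin step preserves descents among the
surviving entries (`IsHoled.isDescent_step`), so by iterating `Δ` only the two smallest entries need
to be compared. The smallest is a descent iff the slide starts downwards, and then the path of the
next slide stays strictly above it; if the slide starts to the right, the next path stays strictly
to its left. The relative position of two consecutive vacated boxes thus records the descent,
including the column condition of `Dsi` (`IsStandard.isDescent_iff_vacated`). (3) By double
counting, the cocharge is the sum of `n - j` over the descending indices `j` (`cc_eq_sum`). With `j
= n - i` the summand is `i`, which gives the major index. Stability follows since appending the
largest letter creates no descending location. -/

theorem lt_of_rowInsert_eq_some {x y : ℕ} {r : List ℕ} (h : (rowInsert x r).2 = some y) :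
    x < y := by
  induction r with
  | nil => simp [rowInsert] at h
  | cons a r ih =>
    rw [rowInsert] at h
    split_ifs at h with hx
    · simp only [Option.some.injEq] at h; omega
    · exact ih h

theorem mem_rowInsert {x z : ℕ} {r : List ℕ} (h : z ∈ (rowInsert x r).1) : z = x ∨ z ∈ r := by
  induction r with
  | nil => simpa [rowInsert] using h
  | cons a r ih =>
    rw [rowInsert] at h
    split_ifs at h with hx
    · simp only [List.mem_cons] at h ⊢; tauto
    · simp only [List.mem_cons] at h ⊢; tauto

theorem pairwise_rowInsert {x : ℕ} {r : List ℕ} (hr : r.Pairwise (· ≤ ·)) :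
    (rowInsert x r).1.Pairwise (· ≤ ·) := by
  induction r with
  | nil => simp [rowInsert]
  | cons a r ih =>
    rw [List.pairwise_cons] at hr
    rw [rowInsert]
    split_ifs with hx
    · exact List.pairwise_cons.2 ⟨fun z hz => by have := hr.1 z hz; omega, hr.2⟩
    · refine List.pairwise_cons.2 ⟨fun z hz => ?_, ih hr.2⟩
      rcases mem_rowInsert hz with rfl | hz
      · omega
      · exact hr.1 z hz

theorem length_rowInsert_of_none {x : ℕ} {r : List ℕ} (h : (rowInsert x r).2 = none) :
    (rowInsert x r).1.length = r.length + 1 := by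
  induction r with
  | nil => simp [rowInsert]
  | cons a r ih =>
    rw [rowInsert] at h ⊢
    split_ifs at h ⊢ with hx
    simpa using ih h

theorem length_rowInsert_of_some {x y : ℕ} {r : List ℕ} (h : (rowInsert x r).2 = some y) :
    (rowInsert x r).1.length = r.length := by
  induction r with
  | nil => simp [rowInsert] at h
  | cons a r ih =>
    rw [rowInsert] at h ⊢
    split_ifs at h ⊢ with hx
    · simp
    · simpa using ih h

/-- The letter `x` is now in the row, preceded only by letters at most `x`. Hence the first letter
exceeding `y` is found at `x` or earlier. -/
theorem rowInsert_rowInsert_of_lt {x y : ℕ} (r : List ℕ) (h : y < x) :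
    ∃ z ≤ x, (rowInsert y (rowInsert x r).1).2 = some z := by
  induction r with
  | nil => exact ⟨x, le_rfl, by simp [rowInsert, h]⟩
  | cons a r ih =>
    by_cases hx : x < a
    · exact ⟨x, le_rfl, by simp [rowInsert, hx, h]⟩
    · by_cases hy : y < a
      · exact ⟨a, by omega, by simp [rowInsert, hx, hy]⟩
      · obtain ⟨z, hz, e⟩ := ih
        exact ⟨z, hz, by simpa [rowInsert, hx, hy] using e⟩

theorem rowInsert_rowInsert_eq_none {x y : ℕ} {r : List ℕ} (h : x ≤ y)
    (hr : (rowInsert x r).2 = none) : (rowInsert y (rowInsert x r).1).2 = none := by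
  induction r with
  | nil => simp [rowInsert, h.not_gt]
  | cons a r ih =>
    by_cases hx : x < a
    · simp [rowInsert, hx] at hr
    · have hy : ¬ y < a := by omega
      simp only [rowInsert, hx, hy, if_false] at hr ⊢
      exact ih hr

theorem mem_of_rowInsert_eq_some {x y : ℕ} {r : List ℕ} (h : (rowInsert x r).2 = some y) :
    y ∈ r := by
  induction r with
  | nil => simp [rowInsert] at h
  | cons a r ih =>
    rw [rowInsert] at h
    split_ifs at h with hx
    · simp only [Option.some.injEq] at h; simp [h]
    · exact List.mem_cons_of_mem _ (ih h)

/-- The second insertion passes over `x` and so bumps a letter further to the right in the sorted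
row. -/
theorem le_of_rowInsert_rowInsert {x y x' y' : ℕ} {r : List ℕ} (hr : r.Pairwise (· ≤ ·))
    (h : x ≤ y) (hx' : (rowInsert x r).2 = some x')
    (hy' : (rowInsert y (rowInsert x r).1).2 = some y') : x' ≤ y' := by
  induction r with
  | nil => simp [rowInsert] at hx'
  | cons a r ih =>
    rw [List.pairwise_cons] at hr
    by_cases hx : x < a
    · have hy : ¬ y < x := by omega
      simp only [rowInsert, hx, hy, if_false, if_true, Option.some.injEq] at hx' hy'
      exact hx' ▸ hr.1 _ (mem_of_rowInsert_eq_some hy')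
    · have hy : ¬ y < a := by omega
      simp only [rowInsert, hx, hy, if_false] at hx' hy'
      exact ih hr.2 hx' hy'

/-! ### Lists of rows that form a tableau -/

/-- The row `s` may stand below the row `r` in a column strict tableau. -/
def Dominates : List ℕ → List ℕ → Prop
  | _, [] => True
  | [], _ :: _ => False
  | a :: r, b :: s => a < b ∧ Dominates r s

theorem Dominates.length_le {r s : List ℕ} (h : Dominates r s) : s.length ≤ r.length := by
  induction r generalizing s with
  | nil => cases s <;> simp_all [Dominates]
  | cons a r ih =>
    cases s with
    | nil => simp
    | cons b s => simpa using ih h.2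

theorem dominates_nil (r : List ℕ) : Dominates r [] := by cases r <;> trivial

theorem Dominates.rowInsert_left {x : ℕ} {r s : List ℕ} (h : Dominates r s) :
    Dominates (rowInsert x r).1 s := by
  induction r generalizing s with
  | nil => cases s <;> simp_all [Dominates]
  | cons a r ih =>
    cases s with
    | nil => exact dominates_nil _
    | cons b s =>
      rw [rowInsert]
      split_ifs with hx
      · exact ⟨hx.trans h.1, h.2⟩
      · exact ⟨h.1, ih h.2⟩

/-- The letter below the one bumped is larger than it, so `y` lands weakly to the left of the column
it came from. There, the letter above it is smaller than `y`. -/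
theorem Dominates.rowInsert {x y : ℕ} {r s : List ℕ} (h : Dominates r s)
    (hy : (rowInsert x r).2 = some y) :
    Dominates (rowInsert x r).1 (CochargeRSK.rowInsert y s).1 := by
  induction r generalizing s with
  | nil => simp [CochargeRSK.rowInsert] at hy
  | cons a r ih =>
    have hxy := lt_of_rowInsert_eq_some hy
    by_cases hx : x < a
    · simp only [CochargeRSK.rowInsert, hx, if_true, Option.some.injEq] at hy ⊢
      subst hy
      cases s with
      | nil => exact ⟨hx, dominates_nil _⟩
      | cons b s =>
        simp only [CochargeRSK.rowInsert, h.1, if_true]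
        exact ⟨hx, h.2⟩
    · simp only [CochargeRSK.rowInsert, hx, if_false] at hy ⊢
      cases s with
      | nil => exact ⟨by omega, dominates_nil _⟩
      | cons b s =>
        by_cases hb : y < b
        · simp only [CochargeRSK.rowInsert, hb, if_true]
          exact ⟨by omega, h.2.rowInsert_left⟩
        · simp only [CochargeRSK.rowInsert, hb, if_false]
          exact ⟨h.1, ih h.2 hy⟩

/-- The rows are weakly increasing and the columns are strictly increasing. -/
def IsTableau : List (List ℕ) → Prop
  | [] => True
  | r :: rs => r.Pairwise (· ≤ ·) ∧ Dominates r (rs.headD []) ∧ IsTableau rs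

theorem headD_rowInsertion (x : ℕ) (P : List (List ℕ)) :
    (rowInsertion x P).1.headD [] = (rowInsert x (P.headD [])).1 := by
  cases P with
  | nil => simp [rowInsertion, rowInsert]
  | cons r rs =>
    rw [rowInsertion]
    split <;> simp_all

theorem IsTableau.rowInsertion {P : List (List ℕ)} (hP : IsTableau P) (x : ℕ) :
    IsTableau (rowInsertion x P).1 := by
  induction P generalizing x with
  | nil => exact ⟨by simp, trivial, trivial⟩
  | cons r rs ih =>
    obtain ⟨h1, h2, h3⟩ := hP
    have hs := pairwise_rowInsert (x := x) h1
    rw [CochargeRSK.rowInsertion]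
    split
    · rename_i r' h
      rw [h] at hs
      refine ⟨hs, ?_, h3⟩
      have := h2.rowInsert_left (x := x)
      rwa [h] at this
    · rename_i r' y h
      rw [h] at hs
      refine ⟨hs, ?_, ih h3 y⟩
      have := h2.rowInsert (x := x) (y := y) (by rw [h])
      rw [h] at this
      rwa [headD_rowInsertion]

/-- The boxes of a list of rows: row `i` has the boxes `(i, j)` with `j` less than its length. -/
def boxes (P : List (List ℕ)) : Set (ℕ × ℕ) := {p | p.2 < (P.getD p.1 []).length}

theorem IsTableau.isLowerSet {P : List (List ℕ)} (hP : IsTableau P) : IsLowerSet (boxes P) := by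
  rintro ⟨i, j⟩ ⟨i', j'⟩ ⟨hi, hj⟩ h
  simp only [boxes, Set.mem_ofPred_eq] at h hi hj ⊢
  refine hj.trans_lt (h.trans_le ?_)
  clear h hj
  induction P generalizing i i' with
  | nil => simp
  | cons r rs ih =>
    obtain ⟨-, h2, h3⟩ := hP
    cases i' with
    | succ i' =>
      obtain ⟨i, rfl⟩ : ∃ k, i = k + 1 := ⟨i - 1, by omega⟩
      simpa using ih h3 _ _ (by omega)
    | zero =>
      cases i with
      | zero => simp
      | succ i =>
        have := ih h3 i 0 (by omega)
        have h4 := h2.length_le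
        cases rs <;> (simp_all; try omega)

theorem boxes_rowInsertion (x : ℕ) (P : List (List ℕ)) :
    boxes (rowInsertion x P).1 = insert (rowInsertion x P).2 (boxes P) := by
  induction P generalizing x with
  | nil =>
    ext ⟨i, j⟩
    cases i <;> simp [boxes, rowInsertion]
  | cons r rs ih =>
    rw [rowInsertion]
    split
    · rename_i r' h
      have := length_rowInsert_of_none (x := x) (r := r) (by rw [h])
      rw [h] at this
      ext ⟨i, j⟩
      cases i
      · simp [boxes, this]; omega
      · simp [boxes]
    · rename_i r' y h
      have := length_rowInsert_of_some (x := x) (y := y) (r := r) (by rw [h])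
      rw [h] at this
      ext ⟨i, j⟩
      cases i with
      | zero => simp_all [boxes, Prod.ext_iff]
      | succ i =>
        have := congrArg (fun s => (i, j) ∈ s) (ih y)
        simpa [boxes, Prod.ext_iff] using this

theorem rowInsertion_box_notMem (x : ℕ) (P : List (List ℕ)) :
    (rowInsertion x P).2 ∉ boxes P := by
  induction P generalizing x with
  | nil => simp [boxes]
  | cons r rs ih =>
    rw [rowInsertion]
    split
    · simp [boxes]
    · rename_i r' y h
      simpa [boxes] using ih y

/-- Induction on the rows. If one of the insertions stops in the first row, comparing `x` and `y`
decides which. If both bump, the bumped letters compare in the same way as `x` and `y`, and they are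
inserted into the remaining rows. Equal letters count as no descent, so arbitrary words are allowed.
-/
theorem rowInsertion_row_lt_iff {P : List (List ℕ)} (hP : IsTableau P) (x y : ℕ) :
    (rowInsertion x P).2.1 < (rowInsertion y (rowInsertion x P).1).2.1 ↔ y < x := by
  induction P generalizing x y with
  | nil =>
    by_cases h : y < x <;> simp [rowInsertion, rowInsert, h]
  | cons r rs ih =>
    obtain ⟨h1, -, h3⟩ := hP
    rcases h : rowInsert x r with ⟨r', _ | x'⟩
    · simp only [rowInsertion, h]
      rcases h' : rowInsert y r' with ⟨r'', _ | y'⟩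
      · simp only [lt_self_iff_false, false_iff]
        intro hlt
        obtain ⟨z, -, hz⟩ := rowInsert_rowInsert_of_lt r hlt
        rw [h, h'] at hz
        simp at hz
      · simp only [Nat.zero_lt_succ, true_iff]
        by_contra hlt
        have := rowInsert_rowInsert_eq_none (x := x) (y := y) (r := r) (by omega) (by rw [h])
        rw [h, h'] at this
        simp at this
    · have hx := lt_of_rowInsert_eq_some (x := x) (y := x') (r := r) (by rw [h])
      simp only [rowInsertion, h]
      rcases h' : rowInsert y r' with ⟨r'', _ | y'⟩
      · simp only [not_lt_zero, false_iff]
        intro hlt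
        obtain ⟨z, -, hz⟩ := rowInsert_rowInsert_of_lt r hlt
        rw [h, h'] at hz
        simp at hz
      · simp only [Nat.add_lt_add_iff_right, ih h3]
        constructor
        · intro hlt
          by_contra hle
          have := le_of_rowInsert_rowInsert (x := x) (y := y) (x' := x') (y' := y') h1 (by omega)
            (by rw [h]) (by rw [h, h'])
          omega
        · intro hlt
          obtain ⟨z, hz', hz⟩ := rowInsert_rowInsert_of_lt r hlt
          rw [h, h'] at hz
          simp only [Option.some.injEq] at hz
          omega

/-! ### Standard tableaux and the recording tableau -/

/-- `T` has the shape of a Young diagram, its rows and columns are strictly increasing, and its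
entries are `a + 1, …, b`, every one occurring once. -/
structure IsStandard (a b : ℕ) (T : Tableau) : Prop where
  lower : IsLowerSet (T.cells : Set (ℕ × ℕ))
  strictMono : StrictMonoOn T.entry T.cells
  bijOn : Set.BijOn T.entry T.cells (Set.Ioc a b)

/-- `i + 1` lies in a strictly lower row of `T` than `i`. -/
def IsDescent (T : Tableau) (i : ℕ) : Prop :=
  ∃ p ∈ T.cells, ∃ q ∈ T.cells, T.entry p = i ∧ T.entry q = i + 1 ∧ p.1 < q.1

theorem IsStandard.card_cells {a b : ℕ} {T : Tableau} (hT : IsStandard a b T) :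
    T.cells.card = b - a := by
  rw [← Nat.card_Ioc a b]
  refine Finset.card_bij (fun p _ => T.entry p) (fun p hp => ?_) (fun p hp q hq h => ?_)
    (fun k hk => ?_)
  · simpa using hT.bijOn.mapsTo hp
  · exact hT.bijOn.injOn hp hq h
  · obtain ⟨p, hp, e⟩ := hT.bijOn.surjOn (by simpa using hk : k ∈ Set.Ioc a b)
    exact ⟨p, hp, e⟩

theorem isTableau_insertionTableau (u : ℕ → ℕ) (k : ℕ) : IsTableau (insertionTableau u k) := by
  induction k with
  | zero => trivial
  | succ k ih => exact ih.rowInsertion _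

theorem coe_cells_recordingTableau (u : ℕ → ℕ) (k : ℕ) :
    ((recordingTableau u k).cells : Set (ℕ × ℕ)) = boxes (insertionTableau u k) := by
  induction k with
  | zero => ext; simp [recordingTableau, insertionTableau, boxes]
  | succ k ih => simp [recordingTableau, insertionTableau, boxes_rowInsertion, ih]

theorem box_notMem_recordingTableau (u : ℕ → ℕ) (k x : ℕ) :
    (rowInsertion x (insertionTableau u k)).2 ∉ (recordingTableau u k).cells := by
  rw [← Finset.mem_coe, coe_cells_recordingTableau]
  exact rowInsertion_box_notMem _ _

theorem isStandard_recordingTableau (u : ℕ → ℕ) (k : ℕ) :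
    IsStandard 0 k (recordingTableau u k) := by
  induction k with
  | zero => exact ⟨by simp [recordingTableau, isLowerSet_empty], by simp [recordingTableau, StrictMonoOn],
      by simp [recordingTableau]⟩
  | succ k ih =>
    have hlow : IsLowerSet ((recordingTableau u (k + 1)).cells : Set (ℕ × ℕ)) := by
      rw [coe_cells_recordingTableau]
      exact (isTableau_insertionTableau u (k + 1)).isLowerSet
    have hb := box_notMem_recordingTableau u k (u (k + 1))
    refine ⟨hlow, ?_, ?_⟩
    · intro p hp q hq hpq
      simp only [recordingTableau, Finset.coe_insert, Set.mem_insert_iff, Finset.mem_coe] at hp hq ⊢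
      rcases hq with rfl | hq
      · rcases hp with rfl | hp
        · exact absurd hpq (lt_irrefl _)
        · have := (ih.bijOn.mapsTo hp).2
          rw [Function.update_self, Function.update_of_ne hpq.ne]
          omega
      · have hp' := ih.lower hpq.le hq
        rw [Function.update_of_ne (ne_of_mem_of_not_mem hp' hb),
          Function.update_of_ne (ne_of_mem_of_not_mem hq hb)]
        exact ih.strictMono hp' hq hpq
    · have e : Set.Ioc 0 (k + 1) = insert (k + 1) (Set.Ioc 0 k) := by
        ext; simp; omega
      simp only [recordingTableau, Finset.coe_insert]
      rw [e]
      have := Set.BijOn.insert (f := Function.update (recordingTableau u k).entry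
        (rowInsertion (u (k + 1)) (insertionTableau u k)).2 (k + 1))
        (a := (rowInsertion (u (k + 1)) (insertionTableau u k)).2)
        (s := (recordingTableau u k).cells) (t := Set.Ioc 0 k)
        (ih.bijOn.congr fun p hp => ?_) (by simp)
      · simpa using this
      · rw [Function.update_of_ne (ne_of_mem_of_not_mem hp hb)]

/-- The box added in the step with number `k`. -/
def addedBox (u : ℕ → ℕ) (k : ℕ) : ℕ × ℕ := (rowInsertion (u k) (insertionTableau u (k - 1))).2

theorem addedBox_mem (u : ℕ → ℕ) {k n : ℕ} (hk : 1 ≤ k) (hn : k ≤ n) :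
    addedBox u k ∈ (recordingTableau u n).cells ∧
      (recordingTableau u n).entry (addedBox u k) = k := by
  induction n, hn using Nat.le_induction with
  | base =>
    obtain ⟨k, rfl⟩ : ∃ m, k = m + 1 := ⟨k - 1, by omega⟩
    simp [recordingTableau, addedBox]
  | succ n hn ih =>
    have hb := box_notMem_recordingTableau u n (u (n + 1))
    simp only [recordingTableau]
    exact ⟨Finset.mem_insert_of_mem ih.1,
      by rw [Function.update_of_ne (ne_of_mem_of_not_mem ih.1 hb), ih.2]⟩

theorem isDescent_recordingTableau (u : ℕ → ℕ) {i n : ℕ} (hi : 1 ≤ i) (hn : i + 1 ≤ n) :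
    IsDescent (recordingTableau u n) i ↔ u (i + 1) < u i := by
  obtain ⟨m1, e1⟩ := addedBox_mem u hi (by omega : i ≤ n)
  obtain ⟨m2, e2⟩ := addedBox_mem u (by omega : 1 ≤ i + 1) hn
  have key : (addedBox u i).1 < (addedBox u (i + 1)).1 ↔ u (i + 1) < u i := by
    obtain ⟨i, rfl⟩ : ∃ m, i = m + 1 := ⟨i - 1, by omega⟩
    exact rowInsertion_row_lt_iff (isTableau_insertionTableau u i) _ _
  rw [← key]
  constructor
  · rintro ⟨p, hp, q, hq, h1, h2, h3⟩
    have hinj := (isStandard_recordingTableau u n).bijOn.injOn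
    rwa [← hinj hp m1 (h1.trans e1.symm), ← hinj hq m2 (h2.trans e2.symm)]
  · intro h
    exact ⟨_, m1, _, m2, e1, e2, h⟩

/-! ### Jeu de taquin slides -/

/-- The empty box after a step of a slide. -/
def slideNext (T : Tableau) (c : ℕ × ℕ) : ℕ × ℕ :=
  if (c.1, c.2 + 1) ∈ T.cells ∧
      ((c.1 + 1, c.2) ∈ T.cells → T.entry (c.1, c.2 + 1) < T.entry (c.1 + 1, c.2)) then
    (c.1, c.2 + 1)
  else if (c.1 + 1, c.2) ∈ T.cells then (c.1 + 1, c.2)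
  else c

theorem slideStep_eq (T : Tableau) (c : ℕ × ℕ) :
    slideStep (T, c) =
      (⟨T.cells, Function.update T.entry c (T.entry (slideNext T c))⟩, slideNext T c) := by
  simp only [slideStep, slideNext]
  split_ifs <;> simp

theorem slideNext_cases (T : Tableau) (c : ℕ × ℕ) :
    (slideNext T c = c ∧ (c.1, c.2 + 1) ∉ T.cells ∧ (c.1 + 1, c.2) ∉ T.cells) ∨
    (slideNext T c = (c.1, c.2 + 1) ∧ (c.1, c.2 + 1) ∈ T.cells ∧
      ((c.1 + 1, c.2) ∈ T.cells → T.entry (c.1, c.2 + 1) < T.entry (c.1 + 1, c.2))) ∨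
    (slideNext T c = (c.1 + 1, c.2) ∧ (c.1 + 1, c.2) ∈ T.cells ∧
      ((c.1, c.2 + 1) ∈ T.cells → T.entry (c.1 + 1, c.2) ≤ T.entry (c.1, c.2 + 1))) := by
  unfold slideNext
  split_ifs with h1 h2
  · exact Or.inr (Or.inl ⟨rfl, h1⟩)
  · refine Or.inr (Or.inr ⟨rfl, h2, fun h => ?_⟩)
    by_contra! hlt
    exact h1 ⟨h, fun _ => hlt⟩
  · exact Or.inl ⟨rfl, fun h => h1 ⟨h, fun h' => absurd h' h2⟩, h2⟩

theorem slideNext_mem {T : Tableau} {c : ℕ × ℕ} (hc : c ∈ T.cells) : slideNext T c ∈ T.cells := by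
  rcases slideNext_cases T c with h | h | h
  · rwa [h.1]
  · rw [h.1]; exact h.2.1
  · rw [h.1]; exact h.2.1

theorem slideNext_congr {T T' : Tableau} {c : ℕ × ℕ} (hc : T'.cells = T.cells)
    (h1 : T'.entry (c.1, c.2 + 1) = T.entry (c.1, c.2 + 1))
    (h2 : T'.entry (c.1 + 1, c.2) = T.entry (c.1 + 1, c.2)) : slideNext T' c = slideNext T c := by
  simp only [slideNext, hc, h1, h2]

/-- `T` has the shape of a Young diagram, and apart from the box `c`, it is filled with the
entries `a + 1, …, b`, with strictly increasing rows and columns. -/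
structure IsHoled (a b : ℕ) (T : Tableau) (c : ℕ × ℕ) : Prop where
  lower : IsLowerSet (T.cells : Set (ℕ × ℕ))
  mem : c ∈ T.cells
  strictMono : StrictMonoOn T.entry (T.cells.erase c)
  bijOn : Set.BijOn T.entry (T.cells.erase c) (Set.Ioc a b)

theorem IsHoled.lt {a b : ℕ} {T : Tableau} {c p q : ℕ × ℕ} (h : IsHoled a b T c)
    (hp : p ≠ c) (hq : q ≠ c) (hqT : q ∈ T.cells) (h1 : p.1 ≤ q.1) (h2 : p.2 ≤ q.2)
    (hne : p ≠ q) : T.entry p < T.entry q := by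
  have hle : p ≤ q := ⟨h1, h2⟩
  refine h.strictMono ?_ ?_ (lt_of_le_of_ne hle hne)
  · simpa [hp] using h.lower hle hqT
  · simpa [hq] using hqT

/-- The entry that moves is the smallest among those weakly right of and weakly below the hole, and
it exceeds everything weakly left of and above the hole. -/
theorem IsHoled.step {a b : ℕ} {T : Tableau} {c : ℕ × ℕ} (h : IsHoled a b T c) :
    IsHoled a b ⟨T.cells, Function.update T.entry c (T.entry (slideNext T c))⟩
      (slideNext T c) := by
  have hmem := slideNext_mem h.mem
  have hcases := slideNext_cases T c
  set d := slideNext T c with hd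
  by_cases hdc : d = c
  · rw [hdc, Function.update_eq_self]
    exact h
  have hcd : c ≤ d := by
    rcases hcases with h' | h' | h'
    · exact absurd h'.1 hdc
    · rw [h'.1]; exact ⟨le_rfl, Nat.le_succ _⟩
    · rw [h'.1]; exact ⟨Nat.le_succ _, le_rfl⟩
  have hmin : ∀ q ∈ T.cells, c < q → q ≠ d → T.entry d < T.entry q := by
    intro q hq hcq hqd
    have hqc := hcq.ne'
    have hle : c.1 ≤ q.1 ∧ c.2 ≤ q.2 := hcq.le
    have hor : c.2 + 1 ≤ q.2 ∨ c.1 + 1 ≤ q.1 := by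
      by_contra! hn
      exact hqc (Prod.ext (by omega) (by omega))
    have nr : ((c.1, c.2 + 1) : ℕ × ℕ) ≠ c := by simp [Prod.ext_iff]
    have nb : ((c.1 + 1, c.2) : ℕ × ℕ) ≠ c := by simp [Prod.ext_iff]
    rcases hcases with h' | h' | h'
    · exact absurd h'.1 hdc
    · rcases hor with hor | hor
      · exact h.lt hdc hqc hq (by simp [h'.1, hle.1]) (by simpa [h'.1] using hor) (Ne.symm hqd)
      · have hb : ((c.1 + 1, c.2) : ℕ × ℕ) ∈ T.cells := h.lower ⟨hor, hle.2⟩ hq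
        have e1 := h'.2.2 hb
        rw [← h'.1] at e1
        by_cases hqb : ((c.1 + 1, c.2) : ℕ × ℕ) = q
        · rwa [← hqb]
        · exact e1.trans (h.lt nb hqc hq hor hle.2 hqb)
    · rcases hor with hor | hor
      · have hb : ((c.1, c.2 + 1) : ℕ × ℕ) ∈ T.cells := h.lower ⟨hle.1, hor⟩ hq
        have e1 := h'.2.2 hb
        rw [← h'.1] at e1
        by_cases hqb : ((c.1, c.2 + 1) : ℕ × ℕ) = q
        · rw [← hqb]
          refine lt_of_le_of_ne e1 fun e => ?_
          have := h.bijOn.injOn (by simp [hdc, hmem]) (by simp [hb, Prod.ext_iff]) e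
          rw [h'.1] at this
          simp [Prod.ext_iff] at this
        · exact e1.trans_lt (h.lt nr hqc hq hle.1 hor hqb)
      · exact h.lt hdc hqc hq (by simpa [h'.1] using hor) (by simp [h'.1, hle.2]) (Ne.symm hqd)
  refine ⟨h.lower, hmem, ?_, ?_⟩
  · intro p hp q hq hpq
    simp only [Finset.coe_erase, Set.mem_sdiff, Finset.mem_coe, Set.mem_singleton_iff] at hp hq ⊢
    by_cases hpc : p = c
    · subst hpc
      rw [Function.update_self, Function.update_of_ne hpq.ne']
      exact hmin q hq.1 hpq hq.2
    · rw [Function.update_of_ne hpc]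
      by_cases hqc : q = c
      · subst hqc
        rw [Function.update_self]
        exact h.lt hpc hdc hmem (hpq.le.trans hcd).1 (hpq.le.trans hcd).2 hp.2
      · rw [Function.update_of_ne hqc]
        exact h.lt hpc hqc hq.1 hpq.le.1 hpq.le.2 hpq.ne
  · refine ⟨fun p hp => ?_, fun p hp q hq hpq => ?_, fun k hk => ?_⟩
    · simp only [Finset.coe_erase, Set.mem_sdiff, Finset.mem_coe, Set.mem_singleton_iff] at hp ⊢
      by_cases hpc : p = c
      · rw [hpc, Function.update_self]
        exact h.bijOn.mapsTo (by simp [hmem, hdc])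
      · rw [Function.update_of_ne hpc]
        exact h.bijOn.mapsTo (by simp [hp.1, hpc])
    · simp only [Finset.coe_erase, Set.mem_sdiff, Finset.mem_coe, Set.mem_singleton_iff]
        at hp hq hpq
      by_cases hpc : p = c <;> by_cases hqc : q = c
      · rw [hpc, hqc]
      · rw [hpc, Function.update_self, Function.update_of_ne hqc] at hpq
        exact absurd (h.bijOn.injOn (by simp [hmem, hdc]) (by simp [hq.1, hqc]) hpq).symm hq.2
      · rw [hqc, Function.update_self, Function.update_of_ne hpc] at hpq
        exact absurd (h.bijOn.injOn (by simp [hp.1, hpc]) (by simp [hmem, hdc]) hpq) hp.2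
      · rw [Function.update_of_ne hpc, Function.update_of_ne hqc] at hpq
        exact h.bijOn.injOn (by simp [hp.1, hpc]) (by simp [hq.1, hqc]) hpq
    · obtain ⟨p, hp, rfl⟩ := h.bijOn.surjOn hk
      simp only [Finset.coe_erase, Set.mem_sdiff, Finset.mem_coe, Set.mem_singleton_iff] at hp
      by_cases hpd : p = d
      · exact ⟨c, by simp [h.mem, Ne.symm hdc], by simp [hpd]⟩
      · exact ⟨p, by simp [hp.1, hpd], by simp [Function.update_of_ne hp.2]⟩

/-- Only a downward choice of `d` changes a row: one entry rises by one row. A descent could appear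
or vanish only if this entry met its predecessor or successor in one of the two rows; in each such
case some entry would lie strictly between `i` and `i + 1`, or rows, columns or the sliding rule
would be violated. -/
theorem IsHoled.isDescent_step {a b : ℕ} {T : Tableau} {c : ℕ × ℕ} (h : IsHoled a b T c)
    (i : ℕ) :
    IsDescent ⟨T.cells.erase (slideNext T c),
      Function.update T.entry c (T.entry (slideNext T c))⟩ i ↔
    IsDescent ⟨T.cells.erase c, T.entry⟩ i := by
  have hmem := slideNext_mem h.mem
  have hcases := slideNext_cases T c
  set d := slideNext T c with hd
  by_cases hdc : d = c
  · rw [hdc, Function.update_eq_self]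
  simp only [IsDescent, Finset.mem_erase]
  have nr : ((c.1, c.2 + 1) : ℕ × ℕ) ≠ c := by simp [Prod.ext_iff]
  constructor
  · rintro ⟨p, ⟨hpd, hp⟩, q, ⟨hqd, hq⟩, e1, e2, hlt⟩
    by_cases hpc : p = c
    · have hqc : q ≠ c := by rintro rfl; subst hpc; exact lt_irrefl _ hlt
      subst hpc
      rw [Function.update_self] at e1
      rw [Function.update_of_ne hqc] at e2
      refine ⟨d, ⟨hdc, hmem⟩, q, ⟨hqc, hq⟩, e1, e2, ?_⟩
      rcases hcases with h' | h' | h'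
      · exact absurd h'.1 hdc
      · simpa [h'.1] using hlt
      · rw [h'.1] at hqd ⊢
        refine lt_of_le_of_ne (Nat.succ_le_of_lt hlt) fun e => ?_
        simp only at e
        -- Here `i` rises from `d`, and `i + 1` is assumed to be in the row of `d`. To the left it
        -- would be smaller than `i`; to the right, the right neighbour of the hole would be
        -- strictly between `i` and `i + 1`.
        rcases lt_trichotomy q.2 p.2 with hc | hc | hc
        · have := h.lt hqc hdc hmem (by rw [h'.1]; exact e.ge) (by rw [h'.1]; exact hc.le)
            (by rwa [h'.1])
          omega
        · exact hqd (Prod.ext e.symm hc)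
        · have hr : ((p.1, p.2 + 1) : ℕ × ℕ) ∈ T.cells := h.lower ⟨hlt.le, hc⟩ hq
          have k1 := h'.2.2 hr
          have k2 := h.lt nr hqc hq hlt.le hc (fun e' => by rw [← e'] at hlt; simp at hlt)
          have k3 : T.entry d ≠ T.entry (p.1, p.2 + 1) := fun e' => by
            have := h.bijOn.injOn (by simp [hdc, hmem]) (by simp [hr, Prod.ext_iff]) e'
            rw [h'.1] at this
            simp [Prod.ext_iff] at this
          rw [← h'.1] at k1
          omega
    · by_cases hqc : q = c
      · subst hqc
        rw [Function.update_self] at e2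
        rw [Function.update_of_ne hpc] at e1
        refine ⟨p, ⟨hpc, hp⟩, d, ⟨hdc, hmem⟩, e1, e2, hlt.trans_le ?_⟩
        rcases hcases with h' | h' | h' <;> simp [h'.1]
      · rw [Function.update_of_ne hpc] at e1
        rw [Function.update_of_ne hqc] at e2
        exact ⟨p, ⟨hpc, hp⟩, q, ⟨hqc, hq⟩, e1, e2, hlt⟩
  · rintro ⟨p, ⟨hpc, hp⟩, q, ⟨hqc, hq⟩, e1, e2, hlt⟩
    by_cases hpd : p = d
    · have hqd : q ≠ d := by rintro rfl; rw [hpd] at hlt; exact lt_irrefl _ hlt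
      refine ⟨c, ⟨Ne.symm hdc, h.mem⟩, q, ⟨hqd, hq⟩, ?_, ?_, lt_of_le_of_lt ?_ hlt⟩
      · rw [Function.update_self, ← hpd, e1]
      · rw [Function.update_of_ne hqc, e2]
      · rcases hcases with h' | h' | h' <;> simp [hpd, h'.1]
    · by_cases hqd : q = d
      · refine ⟨p, ⟨hpd, hp⟩, c, ⟨Ne.symm hdc, h.mem⟩, ?_, ?_, ?_⟩
        · rw [Function.update_of_ne hpc, e1]
        · rw [Function.update_self, ← hqd, e2]
        · rw [hqd] at hlt e2
          rcases hcases with h' | h' | h'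
          · exact absurd h'.1 hdc
          · simpa [h'.1] using hlt
          · have hlt' := hlt
            rw [h'.1] at hlt'
            refine lt_of_le_of_ne (Nat.le_of_lt_succ hlt') fun e => ?_
            -- Here `i + 1` rises into the row assumed to contain `i`. If `i` is to the left of the
            -- hole, the box below it has an entry strictly between; if to the right, the sliding
            -- rule would have moved an entry at most `i`.
            rcases lt_trichotomy p.2 c.2 with hc | hc | hc
            · have hle : ((c.1 + 1, p.2) : ℕ × ℕ) ≤ d := by rw [h'.1]; exact ⟨le_rfl, hc.le⟩
              have hz : ((c.1 + 1, p.2) : ℕ × ℕ) ∈ T.cells := h.lower hle hmem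
              have nz : ((c.1 + 1, p.2) : ℕ × ℕ) ≠ c := by simp [Prod.ext_iff]
              have k1 := h.lt hpc nz hz (by simp [e]) le_rfl
                (fun e' => by have := congrArg Prod.fst e'; simp [e] at this)
              have k2 := h.lt nz hdc hmem hle.1 hle.2
                (fun e' => by have := congrArg Prod.snd e'; simp [h'.1] at this; omega)
              omega
            · exact hpc (Prod.ext e hc)
            · have hr : ((c.1, c.2 + 1) : ℕ × ℕ) ∈ T.cells := h.lower ⟨e.ge, hc⟩ hp
              have k1 := h'.2.2 hr
              rw [← h'.1] at k1
              by_cases hpr : ((c.1, c.2 + 1) : ℕ × ℕ) = p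
              · rw [hpr] at k1; omega
              · have k2 := h.lt nr hpc hp e.ge hc hpr
                omega
      · exact ⟨p, ⟨hpd, hp⟩, q, ⟨hqd, hq⟩, by rw [Function.update_of_ne hpc, e1],
          by rw [Function.update_of_ne hqc, e2], hlt⟩

/-! ### The path of a slide -/

/-- The empty box after `i` steps of the slide of `T` into the upper left box. -/
def slidePath (T : Tableau) (i : ℕ) : ℕ × ℕ := (slideNext T)^[i] (0, 0)

theorem slidePath_succ (T : Tableau) (i : ℕ) :
    slidePath T (i + 1) = slideNext T (slidePath T i) :=
  Function.iterate_succ_apply' _ _ _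

theorem le_slideNext (T : Tableau) (c : ℕ × ℕ) : c ≤ slideNext T c := by
  rcases slideNext_cases T c with h | h | h
  · rw [h.1]
  · rw [h.1]; exact ⟨le_rfl, Nat.le_succ _⟩
  · rw [h.1]; exact ⟨Nat.le_succ _, le_rfl⟩

theorem slidePath_mono (T : Tableau) : Monotone (slidePath T) :=
  monotone_nat_of_le_succ fun i => by rw [slidePath_succ]; exact le_slideNext _ _

theorem slidePath_mem {T : Tableau} (h : (0, 0) ∈ T.cells) (i : ℕ) : slidePath T i ∈ T.cells := by
  induction i with
  | zero => exact h
  | succ i ih => rw [slidePath_succ]; exact slideNext_mem ih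

theorem slidePath_level_le (T : Tableau) (i : ℕ) : (slidePath T i).1 + (slidePath T i).2 ≤ i := by
  induction i with
  | zero => simp [slidePath]
  | succ i ih =>
    rw [slidePath_succ]
    rcases slideNext_cases T (slidePath T i) with h | h | h <;> rw [h.1] <;> (try simp only) <;> omega

/-- A path that pauses once stays put forever, so a path still moving has crossed one antidiagonal
per step. -/
theorem slidePath_level {T : Tableau} {i : ℕ} (h : slidePath T (i + 1) ≠ slidePath T i) :
    (slidePath T i).1 + (slidePath T i).2 = i := by
  induction i with
  | zero => simp [slidePath]
  | succ i ih =>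
    have h1 : slidePath T (i + 1) ≠ slidePath T i := by
      intro e
      exact h (by rw [slidePath_succ, e, ← slidePath_succ, e])
    have h2 := ih h1
    rw [slidePath_succ] at h1 ⊢
    rcases slideNext_cases T (slidePath T i) with h' | h' | h'
    · exact absurd h'.1 h1
    · rw [h'.1]; simp only; omega
    · rw [h'.1]; simp only; omega

/-- The slide alters only boxes already visited, so the entries ahead of the hole, and hence the
path, can be read off from the original `T`. -/
theorem iterate_slideStep (T : Tableau) (i : ℕ) :
    (slideStep^[i] (T, (0, 0))).1.cells = T.cells ∧
    (slideStep^[i] (T, (0, 0))).2 = slidePath T i ∧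
    (∀ q, (∀ j < i, slidePath T j ≠ q) → (slideStep^[i] (T, (0, 0))).1.entry q = T.entry q) ∧
    ∀ j < i, (slideStep^[i] (T, (0, 0))).1.entry (slidePath T j) =
      T.entry (slidePath T (j + 1)) := by
  induction i with
  | zero => simp [slidePath]
  | succ i ih =>
    rw [Function.iterate_succ_apply']
    generalize slideStep^[i] (T, (0, 0)) = s at ih
    obtain ⟨S, c⟩ := s
    obtain ⟨h1, h2, h3, h4⟩ := ih
    simp only at h1 h2 h3 h4
    subst h2
    have hpath : ∀ q, slidePath T i < q → S.entry q = T.entry q := fun q hq =>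
      h3 q fun j hj e => absurd (slidePath_mono T hj.le) (by rw [e]; exact not_le_of_gt hq)
    have hn : slideNext S (slidePath T i) = slideNext T (slidePath T i) :=
      slideNext_congr h1 (hpath _ (Prod.lt_iff.2 (Or.inr ⟨le_rfl, Nat.lt_succ_self _⟩)))
        (hpath _ (Prod.lt_iff.2 (Or.inl ⟨Nat.lt_succ_self _, le_rfl⟩)))
    have he : S.entry (slideNext T (slidePath T i)) = T.entry (slideNext T (slidePath T i)) := by
      rcases (le_slideNext T (slidePath T i)).lt_or_eq with h | h
      · exact hpath _ h
      -- The slide has stopped: the last box is overwritten with its own entry, even if it was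
      -- reached several steps earlier.
      · rw [← h]
        by_cases hj : ∀ j < i, slidePath T j ≠ slidePath T i
        · exact h3 _ hj
        · push Not at hj
          obtain ⟨j, hj, e⟩ := hj
          rw [← e, h4 j hj, slidePath_succ, e, ← h]
    simp only [slideStep_eq, hn, he]
    refine ⟨h1, (slidePath_succ T i).symm, fun q hq => ?_, fun j hj => ?_⟩
    · rw [Function.update_of_ne (hq i (Nat.lt_succ_self i)).symm]
      exact h3 q fun j hj => hq j (by omega)
    · by_cases e : slidePath T j = slidePath T i
      · rw [e, Function.update_self, slidePath_succ, e]
      · rw [Function.update_of_ne e]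
        refine h4 j (lt_of_le_of_ne (by omega) ?_)
        rintro rfl
        exact e rfl

/-! ### The operator `Δ` on standard tableaux -/

theorem IsStandard.zero_mem {a b : ℕ} {T : Tableau} (hT : IsStandard a b T) (h : a < b) :
    (0, 0) ∈ T.cells := by
  obtain ⟨p, hp, -⟩ := hT.bijOn.surjOn (⟨Nat.lt_succ_self a, h⟩ : a + 1 ∈ Set.Ioc a b)
  exact hT.lower ⟨Nat.zero_le _, Nat.zero_le _⟩ hp

theorem IsStandard.entry_zero {a b : ℕ} {T : Tableau} (hT : IsStandard a b T) (h : a < b) :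
    T.entry (0, 0) = a + 1 := by
  obtain ⟨p, hp, e⟩ := hT.bijOn.surjOn (⟨Nat.lt_succ_self a, h⟩ : a + 1 ∈ Set.Ioc a b)
  have hle : ((0, 0) : ℕ × ℕ) ≤ p := ⟨Nat.zero_le _, Nat.zero_le _⟩
  have h1 := hT.strictMono.monotoneOn (hT.zero_mem h) hp hle
  have h2 := (hT.bijOn.mapsTo (hT.zero_mem h)).1
  omega

theorem IsStandard.isHoled {a b : ℕ} {T : Tableau} (hT : IsStandard a b T) (h : a < b) :
    IsHoled (a + 1) b T (0, 0) := by
  refine ⟨hT.lower, hT.zero_mem h, hT.strictMono.mono (by simp), ?_⟩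
  have := hT.bijOn.sdiff_singleton (hT.zero_mem h)
  rw [hT.entry_zero h] at this
  convert this using 1
  · simp
  · ext; simp; omega

theorem IsHoled.iterate {a b : ℕ} {T : Tableau} (h : IsHoled a b T (0, 0)) (i : ℕ) :
    IsHoled a b (slideStep^[i] (T, (0, 0))).1 (slideStep^[i] (T, (0, 0))).2 ∧
    ∀ k, IsDescent ⟨(slideStep^[i] (T, (0, 0))).1.cells.erase (slideStep^[i] (T, (0, 0))).2,
      (slideStep^[i] (T, (0, 0))).1.entry⟩ k ↔ IsDescent ⟨T.cells.erase (0, 0), T.entry⟩ k := by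
  induction i with
  | zero => exact ⟨h, fun k => Iff.rfl⟩
  | succ i ih =>
    rw [Function.iterate_succ_apply']
    generalize slideStep^[i] (T, (0, 0)) = s at ih
    obtain ⟨S, c⟩ := s
    rw [slideStep_eq]
    exact ⟨ih.1.step, fun k => (ih.1.isDescent_step k).trans (ih.2 k)⟩

theorem vacated_eq (T : Tableau) : vacated T = slidePath T T.cells.card :=
  (iterate_slideStep T _).2.1

theorem Δ_cells (T : Tableau) : (Δ T).cells = T.cells.erase (vacated T) := rfl

theorem IsStandard.slideNext_vacated {a b : ℕ} {T : Tableau} (hT : IsStandard a b T)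
    (hab : a < b) : slideNext T (vacated T) = vacated T := by
  rw [vacated_eq, ← slidePath_succ]
  by_contra hne
  have h1 := slidePath_level hne
  have h2 : slidePath T T.cells.card ∈ T.cells := slidePath_mem (hT.zero_mem hab) _
  generalize hN : T.cells.card = N at h1 h2
  generalize slidePath T N = c at h1 h2
  have h3 : Finset.Iic c.1 ×ˢ Finset.Iic c.2 ⊆ T.cells := by
    intro p hp
    simp only [Finset.mem_product, Finset.mem_Iic] at hp
    exact hT.lower ⟨hp.1, hp.2⟩ h2
  have h4 := Finset.card_le_card h3
  rw [Finset.card_product, Nat.card_Iic, Nat.card_Iic, hN] at h4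
  -- A path still moving after `N` steps would be at a box with `c.1 + c.2 = N`, whose rectangle has
  -- `(c.1 + 1) * (c.2 + 1) > N` boxes.
  nlinarith [Nat.zero_le (c.1 * c.2)]

theorem IsStandard.vacated_mem {a b : ℕ} {T : Tableau} (hT : IsStandard a b T)
    (hab : a < b) : vacated T ∈ T.cells := by
  rw [vacated_eq]; exact slidePath_mem (hT.zero_mem hab) _

theorem IsStandard.vacated_corner {a b : ℕ} {T : Tableau} (hT : IsStandard a b T)
    (hab : a < b) : ((vacated T).1, (vacated T).2 + 1) ∉ T.cells ∧
      ((vacated T).1 + 1, (vacated T).2) ∉ T.cells := by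
  have h := hT.slideNext_vacated hab
  rcases slideNext_cases T (vacated T) with h' | h' | h'
  · exact h'.2
  · rw [h'.1] at h; simp [Prod.ext_iff] at h
  · rw [h'.1] at h; simp [Prod.ext_iff] at h

theorem IsStandard.eq_vacated {a b : ℕ} {T : Tableau} (hT : IsStandard a b T)
    (hab : a < b) {q : ℕ × ℕ} (hq : q ∈ T.cells) (h1 : (vacated T).1 ≤ q.1)
    (h2 : (vacated T).2 ≤ q.2) : q = vacated T := by
  obtain ⟨hr, hb⟩ := hT.vacated_corner hab
  by_contra hne
  have : (vacated T).2 + 1 ≤ q.2 ∨ (vacated T).1 + 1 ≤ q.1 := by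
    by_contra! hn
    exact hne (Prod.ext (by omega) (by omega))
  rcases this with h | h
  · exact hr (hT.lower ⟨h1, h⟩ hq)
  · exact hb (hT.lower ⟨h, h2⟩ hq)

theorem IsStandard.delta {a b : ℕ} {T : Tableau} (hT : IsStandard a b T) (hab : a < b) :
    IsStandard (a + 1) b (Δ T) := by
  have h := ((hT.isHoled hab).iterate T.cells.card).1
  have hc := (iterate_slideStep T T.cells.card).1
  refine ⟨?_, ?_, ?_⟩
  · intro q p hpq hq
    simp only [Δ_cells, Finset.coe_erase, Set.mem_sdiff, Finset.mem_coe,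
      Set.mem_singleton_iff] at hq ⊢
    refine ⟨hT.lower hpq hq.1, ?_⟩
    rintro rfl
    exact hq.2 (hT.eq_vacated hab hq.1 hpq.1 hpq.2)
  · have := h.strictMono
    rwa [hc] at this
  · have := h.bijOn
    rwa [hc] at this

/-- The bound on `i` keeps the removed entry `a + 1` out of the comparison. -/
theorem IsStandard.isDescent_delta {a b i : ℕ} {T : Tableau} (hT : IsStandard a b T)
    (hab : a < b) (hi : a + 2 ≤ i) : IsDescent (Δ T) i ↔ IsDescent T i := by
  have h := ((hT.isHoled hab).iterate T.cells.card).2 i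
  rw [(iterate_slideStep T T.cells.card).1] at h
  refine Iff.trans h ?_
  have h0 := hT.entry_zero hab
  constructor
  · rintro ⟨p, hp, q, hq, h'⟩
    exact ⟨p, Finset.mem_of_mem_erase hp, q, Finset.mem_of_mem_erase hq, h'⟩
  · rintro ⟨p, hp, q, hq, h1, h2, h3⟩
    refine ⟨p, Finset.mem_erase.2 ⟨?_, hp⟩, q, Finset.mem_erase.2 ⟨?_, hq⟩, h1, h2, h3⟩
    · rintro rfl; omega
    · rintro rfl; omega

theorem IsStandard.slidePath_eq_vacated {a b i : ℕ} {T : Tableau} (hT : IsStandard a b T)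
    (hab : a < b) (hi : slidePath T (i + 1) = slidePath T i) : slidePath T i = vacated T := by
  have h1 : ∀ m, slidePath T (i + m) = slidePath T i := by
    intro m
    induction m with
    | zero => rfl
    | succ m ih => rw [← add_assoc, slidePath_succ, ih, ← slidePath_succ, hi]
  have h2 : ∀ m, slidePath T (T.cells.card + m) = vacated T := by
    intro m
    induction m with
    | zero => rw [vacated_eq]; rfl
    | succ m ih => rw [← add_assoc, slidePath_succ, ih, hT.slideNext_vacated hab]
  rw [← h1 T.cells.card, add_comm, h2]

theorem IsStandard.slidePath_le_vacated {a b : ℕ} {T : Tableau} (hT : IsStandard a b T)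
    (hab : a < b) (i : ℕ) : slidePath T i ≤ vacated T := by
  by_cases hi : i ≤ T.cells.card
  · rw [vacated_eq]; exact slidePath_mono T hi
  · refine (hT.slidePath_eq_vacated hab ?_).le
    by_contra hne
    have h1 := slidePath_level hne
    have h2 : slidePath T i ∈ T.cells := slidePath_mem (hT.zero_mem hab) _
    have h3 := hT.eq_vacated hab h2 ?_ ?_
    · have := slidePath_level_le T T.cells.card
      rw [← vacated_eq, ← h3] at this
      omega
    all_goals
      rw [vacated_eq]
    · exact (slidePath_mono T (by omega : T.cells.card ≤ i)).1
    · exact (slidePath_mono T (by omega : T.cells.card ≤ i)).2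

theorem IsStandard.delta_entry_slidePath {a b i : ℕ} {T : Tableau} (hT : IsStandard a b T)
    (hab : a < b) (hi : slidePath T (i + 1) ≠ slidePath T i) :
    (Δ T).entry (slidePath T i) = T.entry (slidePath T (i + 1)) := by
  refine (iterate_slideStep T T.cells.card).2.2.2 i ?_
  by_contra! h
  have h1 := hT.slidePath_le_vacated hab (i + 1)
  have h2 := slidePath_mono T h
  rw [← vacated_eq] at h2
  exact hi (le_antisymm (h1.trans h2) (slidePath_mono T (Nat.le_succ i)))

theorem delta_entry_of_notMem {T : Tableau} {q : ℕ × ℕ} (hq : ∀ j, slidePath T j ≠ q) :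
    (Δ T).entry q = T.entry q :=
  (iterate_slideStep T T.cells.card).2.2.1 q fun j _ => hq j

/-- If the first slide begins downwards, then the second one stays above it. -/
theorem IsStandard.slidePath_delta_row {a b : ℕ} {T : Tableau} (hT : IsStandard a b T)
    (hab : a < b) (h1 : slidePath T 1 = (1, 0)) (i : ℕ) :
    (slidePath (Δ T) i).1 < (slidePath T (i + 1)).1 := by
  induction i with
  | zero => simp [slidePath, show slideNext T (0, 0) = (1, 0) from h1]
  | succ i ih =>
    have hm := (slidePath_mono T (Nat.le_succ (i + 1))).1
    by_contra! hlt
    have hc := slideNext_cases (Δ T) (slidePath (Δ T) i)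
    rw [← slidePath_succ] at hc
    rcases hc with hc | hc | hc
    · rw [hc.1] at hlt; simp only [Nat.succ_eq_add_one] at *; omega
    · rw [hc.1] at hlt; simp only [Nat.succ_eq_add_one] at *; omega
    -- The paths are compared on consecutive antidiagonals. The inequality can fail only if the
    -- second path steps down from `q` onto the box just below, while the first path reaches that
    -- row and remains in it. If the first path ends there, the box below `q` is no longer in `Δ T`.
    -- Otherwise it goes right, so the entry below `q` in `Δ T` comes from `(q.1 + 1, q.2 + 1)` and
    -- exceeds the entry to the right of `q`: the second slide would have gone right.
    obtain ⟨hq, hmem, hle⟩ := hc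
    have hlev := slidePath_level (T := Δ T) (i := i) (by rw [hq]; simp [Prod.ext_iff])
    rw [hq] at hlt
    set q := slidePath (Δ T) i with hqdef
    simp only [Nat.succ_eq_add_one] at hlt hm
    have hrow : (slidePath T (i + 1)).1 = q.1 + 1 := by omega
    have hrow' : (slidePath T (i + 1 + 1)).1 = q.1 + 1 := by omega
    rw [Δ_cells, Finset.mem_erase] at hmem
    have hv := hT.slidePath_le_vacated hab (i + 1)
    by_cases hst : slidePath T (i + 1 + 1) = slidePath T (i + 1)
    · have hv' := hT.slidePath_eq_vacated hab hst
      have hl := slidePath_level_le T (i + 1)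
      rw [hv'] at hrow hl
      exact hmem.1 (hT.eq_vacated hab hmem.2 (by simp [hrow]) (by simp only; omega))
    · have hl := slidePath_level hst
      have hb : slidePath T (i + 1) = (q.1 + 1, q.2) := Prod.ext hrow (by simp only; omega)
      have hent := hT.delta_entry_slidePath hab hst
      have hmem2 := slidePath_mem (hT.zero_mem hab) (i + 1 + 1)
      have hc := slideNext_cases T (slidePath T (i + 1))
      rw [← slidePath_succ] at hc
      rcases hc with hc | hc | hc
      · exact hst hc.1
      · rw [hc.1, hb] at hent
        rw [hc.1, hb] at hmem2
        simp only at hent hmem2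
        have hr : ((q.1, q.2 + 1) : ℕ × ℕ) ∈ T.cells :=
          hT.lower (show (q.1, q.2 + 1) ≤ (q.1 + 1, q.2 + 1) from ⟨Nat.le_succ _, le_rfl⟩) hmem2
        have hrv : ((q.1, q.2 + 1) : ℕ × ℕ) ≠ vacated T := by
          intro e
          have := hv.1
          rw [← e, hb] at this
          simp at this
        have hr' := hle (by rw [Δ_cells]; exact Finset.mem_erase.2 ⟨hrv, hr⟩)
        have hlt' : T.entry (q.1, q.2 + 1) < T.entry (q.1 + 1, q.2 + 1) :=
          hT.strictMono hr hmem2 (Prod.lt_iff.2 (Or.inl ⟨Nat.lt_succ_self _, le_rfl⟩))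
        rw [delta_entry_of_notMem (q := (q.1, q.2 + 1)), hent] at hr'
        · omega
        · intro j e
          have hj := slidePath_level_le T j
          rw [e] at hj
          simp only at hj
          have := (slidePath_mono T (by omega : i + 1 ≤ j)).1
          rw [e, hb] at this
          simp at this
      · rw [hc.1, hb] at hrow'
        simp at hrow'

/-- If the first slide begins to the right, then the second one stays to the left of it. -/
theorem IsStandard.slidePath_delta_col {a b : ℕ} {T : Tableau} (hT : IsStandard a b T)
    (hab : a < b) (h1 : slidePath T 1 = (0, 1)) (i : ℕ) :
    (slidePath (Δ T) i).2 < (slidePath T (i + 1)).2 := by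
  induction i with
  | zero => simp [slidePath, show slideNext T (0, 0) = (0, 1) from h1]
  | succ i ih =>
    have hm := (slidePath_mono T (Nat.le_succ (i + 1))).2
    by_contra! hlt
    have hc := slideNext_cases (Δ T) (slidePath (Δ T) i)
    rw [← slidePath_succ] at hc
    rcases hc with hc | hc | hc
    · rw [hc.1] at hlt; simp only [Nat.succ_eq_add_one] at *; omega
    swap
    · rw [hc.1] at hlt; simp only [Nat.succ_eq_add_one] at *; omega
    -- The transpose of the argument in `IsStandard.slidePath_delta_row`.
    obtain ⟨hq, hmem, hle⟩ := hc
    have hlev := slidePath_level (T := Δ T) (i := i) (by rw [hq]; simp [Prod.ext_iff])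
    rw [hq] at hlt
    set q := slidePath (Δ T) i with hqdef
    simp only [Nat.succ_eq_add_one] at hlt hm
    have hrow : (slidePath T (i + 1)).2 = q.2 + 1 := by omega
    have hrow' : (slidePath T (i + 1 + 1)).2 = q.2 + 1 := by omega
    rw [Δ_cells, Finset.mem_erase] at hmem
    have hv := hT.slidePath_le_vacated hab (i + 1)
    by_cases hst : slidePath T (i + 1 + 1) = slidePath T (i + 1)
    · have hv' := hT.slidePath_eq_vacated hab hst
      have hl := slidePath_level_le T (i + 1)
      rw [hv'] at hrow hl
      exact hmem.1 (hT.eq_vacated hab hmem.2 (by simp only; omega) (by simp [hrow]))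
    · have hl := slidePath_level hst
      have hb : slidePath T (i + 1) = (q.1, q.2 + 1) := Prod.ext (by simp only; omega) hrow
      have hent := hT.delta_entry_slidePath hab hst
      have hmem2 := slidePath_mem (hT.zero_mem hab) (i + 1 + 1)
      have hc := slideNext_cases T (slidePath T (i + 1))
      rw [← slidePath_succ] at hc
      rcases hc with hc | hc | hc
      · exact hst hc.1
      · rw [hc.1, hb] at hrow'
        simp at hrow'
      · rw [hc.1, hb] at hent
        rw [hc.1, hb] at hmem2
        simp only at hent hmem2
        have hr : ((q.1 + 1, q.2) : ℕ × ℕ) ∈ T.cells :=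
          hT.lower (show (q.1 + 1, q.2) ≤ (q.1 + 1, q.2 + 1) from ⟨le_rfl, Nat.le_succ _⟩) hmem2
        have hrv : ((q.1 + 1, q.2) : ℕ × ℕ) ≠ vacated T := by
          intro e
          have := hv.2
          rw [← e, hb] at this
          simp at this
        have hr' := hle (by rw [Δ_cells]; exact Finset.mem_erase.2 ⟨hrv, hr⟩)
        have hlt' : T.entry (q.1 + 1, q.2) < T.entry (q.1 + 1, q.2 + 1) :=
          hT.strictMono hr hmem2 (Prod.lt_iff.2 (Or.inr ⟨le_rfl, Nat.lt_succ_self _⟩))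
        rw [delta_entry_of_notMem (q := (q.1 + 1, q.2)), hent] at hr'
        · omega
        · intro j e
          have hj := slidePath_level_le T j
          rw [e] at hj
          simp only at hj
          have := (slidePath_mono T (by omega : i + 1 ≤ j)).2
          rw [e, hb] at this
          simp at this

/-- After one step the upper left box holds the minimum of the remaining entries. -/
theorem IsStandard.entry_slidePath_one {a b : ℕ} {T : Tableau} (hT : IsStandard a b T)
    (hab : a + 1 < b) : T.entry (slidePath T 1) = a + 2 ∧
      (slidePath T 1 = (0, 1) ∨ slidePath T 1 = (1, 0)) := by
  have hH := hT.isHoled (by omega)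
  have hS := hH.step
  have h0 := hT.entry_zero (by omega)
  obtain ⟨q, hq, e⟩ := hT.bijOn.surjOn (⟨by omega, by omega⟩ : a + 2 ∈ Set.Ioc a b)
  have hq0 : q ≠ (0, 0) := by rintro rfl; omega
  have hne : slideNext T (0, 0) ≠ (0, 0) := by
    rcases slideNext_cases T (0, 0) with h | h | h
    · have : 1 ≤ q.2 ∨ 1 ≤ q.1 := by
        by_contra! hn
        exact hq0 (Prod.ext (by simp only; omega) (by simp only; omega))
      rcases this with h' | h'
      · exact absurd (hT.lower (show ((0, 1) : ℕ × ℕ) ≤ q from ⟨Nat.zero_le _, h'⟩) hq) h.2.1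
      · exact absurd (hT.lower (show ((1, 0) : ℕ × ℕ) ≤ q from ⟨h', Nat.zero_le _⟩) hq) h.2.2
    · rw [h.1]; simp
    · rw [h.1]; simp
  have hmem := hH.bijOn.mapsTo (x := slideNext T (0, 0))
    (by simpa [hne] using slideNext_mem hH.mem)
  refine ⟨?_, ?_⟩
  · change T.entry (slideNext T (0, 0)) = a + 2
    by_cases hqd : q = slideNext T (0, 0)
    · rw [← hqd]; exact e
    · have := hS.lt (p := (0, 0)) (q := q) hne.symm hqd hq (Nat.zero_le _) (Nat.zero_le _) hq0.symm
      simp only [Function.update_self, Function.update_of_ne hq0, e] at this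
      have := hmem.1
      omega
  · change slideNext T (0, 0) = _ ∨ slideNext T (0, 0) = _
    rcases slideNext_cases T (0, 0) with h | h | h
    · exact absurd h.1 hne
    · exact Or.inl h.1
    · exact Or.inr h.1

theorem IsStandard.card_delta {a b : ℕ} {T : Tableau} (hT : IsStandard a b T) (hab : a < b) :
    (Δ T).cells.card + 1 = T.cells.card := by
  rw [Δ_cells, Finset.card_erase_add_one (hT.vacated_mem hab)]

/-- The entry `a + 2` is the first to move, so the left side says that the slide starts downwards.
The comparison of the two paths carries this over to their endpoints. -/
theorem IsStandard.isDescent_iff_vacated {a b : ℕ} {T : Tableau} (hT : IsStandard a b T)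
    (hab : a + 1 < b) :
    IsDescent T (a + 1) ↔ (vacated (Δ T)).1 < (vacated T).1 ∧
      (vacated T).2 ≤ (vacated (Δ T)).2 := by
  have hab' : a < b := by omega
  have hT' := hT.delta hab'
  obtain ⟨he, hor⟩ := hT.entry_slidePath_one hab
  have h0 := hT.entry_zero hab'
  have hm := slidePath_mem (hT.zero_mem hab') 1
  have hd : IsDescent T (a + 1) ↔ 0 < (slidePath T 1).1 := by
    constructor
    · rintro ⟨p, hp, q, hq, h1, h2, h3⟩
      have : q = slidePath T 1 := hT.bijOn.injOn hq hm (by rw [he, h2])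
      rw [← this]
      omega
    · intro h
      exact ⟨_, hT.zero_mem hab', _, hm, h0, he, h⟩
  -- Losing one box in `Δ T` matches the index shift in the comparison of the paths.
  have hv : vacated T = slidePath T ((Δ T).cells.card + 1) := by
    rw [hT.card_delta hab', vacated_eq]
  rw [hd]
  rcases hor with h | h
  · have hlt := hT.slidePath_delta_col hab' h (Δ T).cells.card
    rw [← hv, ← vacated_eq] at hlt
    rw [h]
    simp only [lt_irrefl, false_iff, not_and]
    intro _
    omega
  · have hlt := hT.slidePath_delta_row hab' h (Δ T).cells.card
    rw [← hv, ← vacated_eq] at hlt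
    rw [h]
    simp only [Nat.lt_one_iff, true_iff]
    refine ⟨hlt, ?_⟩
    -- Otherwise the right neighbour of the second vacated box would still belong to `Δ T`, although
    -- that box is a corner.
    by_contra! hcol
    have hle : (((vacated (Δ T)).1, (vacated (Δ T)).2 + 1) : ℕ × ℕ) ≤ vacated T := ⟨hlt.le, hcol⟩
    refine (hT'.vacated_corner hab).1 ?_
    rw [Δ_cells T, Finset.mem_erase]
    refine ⟨fun e => ?_, hT.lower hle (hT.vacated_mem hab')⟩
    rw [← e] at hlt
    exact lt_irrefl _ hlt

/-! ### Evacuation -/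

theorem evEntry_vacated (n : ℕ) (T : Tableau) : evEntry (n + 1) T (vacated T) = n + 1 := by
  simp [evEntry]

theorem evEntry_of_ne (n : ℕ) {T : Tableau} {p : ℕ × ℕ} (hp : p ≠ vacated T) :
    evEntry (n + 1) T p = evEntry n (Δ T) p := by
  simp [evEntry, Function.update_of_ne hp]

theorem bijOn_evEntry {n a : ℕ} {T : Tableau} (hT : IsStandard a (a + n) T) :
    Set.BijOn (evEntry n T) T.cells (Set.Ioc 0 n) := by
  induction n generalizing a T with
  | zero =>
    have : T.cells = ∅ := Finset.card_eq_zero.1 (by rw [hT.card_cells]; omega)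
    simp [this]
  | succ n ih =>
    have hab : a < a + (n + 1) := by omega
    have hT' : IsStandard (a + 1) (a + 1 + n) (Δ T) := by
      have := hT.delta hab
      rwa [show a + 1 + n = a + (n + 1) by omega]
    have hi : (T.cells : Set (ℕ × ℕ)) = insert (vacated T) ((Δ T).cells : Set (ℕ × ℕ)) := by
      rw [Δ_cells, ← Finset.coe_insert, Finset.insert_erase (hT.vacated_mem hab)]
    have e : Set.Ioc 0 (n + 1) = insert (evEntry (n + 1) T (vacated T)) (Set.Ioc 0 n) := by
      rw [evEntry_vacated]; ext; simp; omega
    rw [hi, e]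
    refine Set.BijOn.insert ((ih hT').congr fun p hp => ?_) (by simp [evEntry_vacated])
    refine (evEntry_of_ne n ?_).symm
    rintro rfl
    simp [Δ_cells] at hp

/-- Induction via `Δ`, which keeps `a + n` fixed. The two largest entries of the evacuation sit in
the boxes vacated by the first two slides; smaller indices are inherited from `Δ T`. -/
theorem evEntry_descent {n a i : ℕ} {T : Tableau} (hT : IsStandard a (a + n) T) (hi : 1 ≤ i)
    (hn : i < n) :
    (∃ p ∈ T.cells, ∃ q ∈ T.cells, evEntry n T p = i ∧ evEntry n T q = i + 1 ∧
      p.1 < q.1 ∧ q.2 ≤ p.2) ↔ IsDescent T (a + n - i) := by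
  induction n generalizing a T with
  | zero => omega
  | succ n ih =>
    have hab : a < a + (n + 1) := by omega
    have hT' : IsStandard (a + 1) (a + 1 + n) (Δ T) := by
      have := hT.delta hab
      rwa [show a + 1 + n = a + (n + 1) by omega]
    have hv := hT.vacated_mem hab
    have hinj := (bijOn_evEntry hT).injOn
    rcases (show i < n ∨ i = n by omega) with hin | rfl
    · have hne : ∀ p, evEntry (n + 1) T p ≤ n → p ≠ vacated T := by
        rintro p hp rfl
        rw [evEntry_vacated] at hp
        omega
      rw [show a + (n + 1) - i = a + 1 + n - i by omega, ← hT.isDescent_delta hab (by omega),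
        ← ih hT' hin]
      constructor
      · rintro ⟨p, hp, q, hq, h1, h2, h3⟩
        have np := hne p (by omega)
        have nq := hne q (by omega)
        rw [evEntry_of_ne n np] at h1
        rw [evEntry_of_ne n nq] at h2
        exact ⟨p, Finset.mem_erase.2 ⟨np, hp⟩, q, Finset.mem_erase.2 ⟨nq, hq⟩, h1, h2, h3⟩
      · rintro ⟨p, hp, q, hq, h1, h2, h3⟩
        rw [Δ_cells, Finset.mem_erase] at hp hq
        exact ⟨p, hp.2, q, hq.2, by rw [evEntry_of_ne n hp.1, h1],
          by rw [evEntry_of_ne n hq.1, h2], h3⟩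
    · have hv' := hT'.vacated_mem (by omega)
      rw [Δ_cells, Finset.mem_erase] at hv'
      have e1 : evEntry (i + 1) T (vacated (Δ T)) = i := by
        rw [evEntry_of_ne i hv'.1]
        obtain ⟨m, rfl⟩ : ∃ m, i = m + 1 := ⟨i - 1, by omega⟩
        exact evEntry_vacated _ _
      rw [show a + (i + 1) - i = a + 1 by omega, hT.isDescent_iff_vacated (by omega)]
      constructor
      · rintro ⟨p, hp, q, hq, h1, h2, h3⟩
        rwa [← hinj hp hv'.2 (h1.trans e1.symm),
          ← hinj hq hv (h2.trans (evEntry_vacated i T).symm)]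
      · intro h
        exact ⟨_, hv'.2, _, hv, e1, evEntry_vacated _ _, h⟩

theorem IsStandard.mem_Dsi_ev {n i : ℕ} {T : Tableau} (hT : IsStandard 0 n T) :
    i ∈ Dsi (ev T) ↔ i ∈ Finset.Icc 1 (n - 1) ∧ IsDescent T (n - i) := by
  have hc : T.cells.card = n := by simpa using hT.card_cells
  rw [Dsi, Finset.mem_filter]
  simp only [ev, hc]
  refine and_congr_right fun h => ?_
  rw [Finset.mem_Icc] at h
  rw [← Nat.zero_add n] at hT
  simpa using evEntry_descent hT h.1 (by omega)

/-! ### Cocharge and the major index -/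

/-- Double counting in the cocharge tableau. -/
theorem cc_eq_sum {n : ℕ} {S : Tableau} (hS : Set.BijOn S.entry S.cells (Set.Ioc 0 n)) :
    cc S = ∑ j ∈ Dsi S, (n - j) := by
  have h1 : cc S = ∑ c ∈ S.cells, ((Dsi S).filter fun j => j < S.entry c).card := rfl
  have h2 : ∑ c ∈ S.cells, ((Dsi S).filter fun j => j < S.entry c).card =
      ∑ k ∈ Finset.Ioc 0 n, ((Dsi S).filter fun j => j < k).card := by
    refine Finset.sum_bij (fun c _ => S.entry c) (fun c hc => ?_) (fun c hc d hd h => ?_)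
      (fun k hk => ?_) (fun _ _ => rfl)
    · simpa using hS.mapsTo hc
    · exact hS.injOn hc hd h
    · obtain ⟨p, hp, e⟩ := hS.surjOn (by simpa using hk : k ∈ Set.Ioc 0 n)
      exact ⟨p, hp, e⟩
  rw [h1, h2]
  simp only [Finset.card_filter]
  rw [Finset.sum_comm]
  -- A fixed `j` is counted once for each `k` with `j < k ≤ n`.
  refine Finset.sum_congr rfl fun j _ => ?_
  rw [← Finset.card_filter, ← Nat.card_Ioc]
  congr 1
  ext k
  simp only [Finset.mem_filter, Finset.mem_Ioc]
  omega

theorem cc_Qtilde {n : ℕ} (w : Equiv.Perm (Fin n)) : cc (Qtilde w) = ∑ i ∈ Dsl w, i := by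
  have hT : IsStandard 0 n (Q w) := isStandard_recordingTableau _ _
  have hc : (Q w).cells.card = n := by simpa using hT.card_cells
  have hb : Set.BijOn (Qtilde w).entry (Qtilde w).cells (Set.Ioc 0 n) := by
    simp only [Qtilde, ev, hc]
    exact bijOn_evEntry (a := 0) (by simpa using hT)
  have hdes : ∀ {i}, i ∈ Finset.Icc 1 (n - 1) →
      (IsDescent (Q w) i ↔ oneLine w (i + 1) < oneLine w i) := fun hi => by
    rw [Finset.mem_Icc] at hi
    exact isDescent_recordingTableau _ hi.1 (by omega)
  rw [cc_eq_sum hb]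
  refine Finset.sum_bij' (fun j _ => n - j) (fun i _ => n - i) ?_ ?_ ?_ ?_ (fun _ _ => rfl)
  · intro j hj
    rw [Qtilde, hT.mem_Dsi_ev] at hj
    have hj' := Finset.mem_Icc.1 hj.1
    have hm : n - j ∈ Finset.Icc 1 (n - 1) := Finset.mem_Icc.2 (by omega)
    exact Finset.mem_filter.2 ⟨hm, (hdes hm).1 hj.2⟩
  · intro i hi
    rw [Dsl, Finset.mem_filter] at hi
    have hi' := Finset.mem_Icc.1 hi.1
    rw [Qtilde, hT.mem_Dsi_ev, show n - (n - i) = i by omega, hdes hi.1]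
    exact ⟨Finset.mem_Icc.2 (by omega), hi.2⟩
  · intro j hj
    rw [Qtilde, hT.mem_Dsi_ev, Finset.mem_Icc] at hj
    omega
  · intro i hi
    rw [Dsl, Finset.mem_filter, Finset.mem_Icc] at hi
    omega

/-! ### Stability under adding a fixed point -/

theorem oneLine_plus {n i : ℕ} (w : Equiv.Perm (Fin n)) (hi : i ≤ n) :
    oneLine (plus w) i = oneLine w i := by
  unfold oneLine
  by_cases h : 1 ≤ i
  · rw [dif_pos ⟨h, by omega⟩, dif_pos ⟨h, hi⟩]
    have := w.viaFintypeEmbedding_apply_image Fin.castSuccEmb ⟨i - 1, by omega⟩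
    have e : (Fin.castSuccEmb ⟨i - 1, by omega⟩ : Fin (n + 1)) = ⟨i - 1, by omega⟩ := rfl
    rw [e] at this
    rw [plus, this]
    rfl
  · rw [dif_neg (by omega), dif_neg (by omega)]

theorem oneLine_plus_last {n : ℕ} (w : Equiv.Perm (Fin n)) :
    oneLine (plus w) (n + 1) = n + 1 := by
  have : plus w (Fin.last n) = Fin.last n := by
    refine w.viaFintypeEmbedding_apply_notMem_range Fin.castSuccEmb ?_
    rintro ⟨j, hj⟩
    exact (Fin.castSucc_lt_last j).ne hj
  unfold oneLine
  rw [dif_pos (by omega)]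
  have e : (⟨n + 1 - 1, by omega⟩ : Fin (n + 1)) = Fin.last n := rfl
  rw [e, this]
  rfl

/-- The only new candidate is location `n`, which is followed by the maximal letter `n + 1`. -/
theorem Dsl_plus {n : ℕ} (w : Equiv.Perm (Fin n)) : Dsl (plus w) = Dsl w := by
  ext i
  simp only [Dsl, Finset.mem_filter, Finset.mem_Icc]
  rcases lt_trichotomy i n with h | rfl | h
  · rw [oneLine_plus w h, oneLine_plus w h.le]
    refine and_congr_left fun _ => ?_
    omega
  · rw [oneLine_plus_last, oneLine_plus w le_rfl]
    have : oneLine w i ≤ i := by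
      unfold oneLine
      split_ifs
      · exact (w _).isLt
      · exact Nat.zero_le _
    omega
  · omega

end CochargeRSK

theorem mainTheorem9 (n : ℕ) (w : Equiv.Perm (Fin n)) :
    CochargeRSK.cc (CochargeRSK.Qtilde w) = ∑ i ∈ CochargeRSK.Dsl w, i ∧
      CochargeRSK.cc (CochargeRSK.Qtilde (CochargeRSK.plus w)) =
        CochargeRSK.cc (CochargeRSK.Qtilde w) := by
  refine ⟨CochargeRSK.cc_Qtilde w, ?_⟩
  rw [CochargeRSK.cc_Qtilde, CochargeRSK.cc_Qtilde, CochargeRSK.Dsl_plus]
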